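/- **Conventions.** For $\mathcal P,\mathcal Q\subseteq\omega^\omega$ let $\mathcal P\oplus\mathcal Q=\{f\oplus g\mid f\in\mathcal P,\ g\in\mathcal Q\}$ and $\mathcal P\otimes\mathcal Q=0^\frown\mathcal P\cup 1^\frown\mathcal Q$. Families $(\mathcal F_y)_{y\in Y}$ of subsets of $\omega^\omega$, with $Y\subseteq\omega^k$, are compared by $\mathcal F\le\mathcal G$ iff there is one partial Turing functional $\Phi$ with $\Phi(y^\frown\mathcal G_y)\subseteq\mathcal F_y$ for all $y\in Y$; families are identified if $\mathcal F\le\mathcal G\le\mathcal F$. For one-point $Y$ ($k=0$) this is Medvedev reducibility $\le_{\mathcal M}$, and for $Y=\omega$ it is reducibility $\le_{\mathcal M_\omega}$ of $\omega$-mass problems. **Intervals.** Let $\mathcal A,\mathcal B_{-1},\mathcal B_0,\mathcal B_1,\dots\subseteq\omega^\omega$ satisfy $(\mathcal A,\mathcal A,\dots)\ge_{\mathcal M_\omega}(\mathcal B_i)_{i\in\omega}\ge_{\mathcal M_\omega}(\mathcal B_{-1},\mathcal B_{-1},\dots)$ and $\mathcal B_i\not\ge_{\mathcal M}\mathcal A$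 for all $i\ge-1$. Put $\mathcal B_{(y_1,\dots,y_k)}=\mathcal B_{y_1}\oplus\dots\oplus\mathcal B_{y_k}$ and $\mathcal B_{()}=\mathcal B_{-1}$. The general interval $[(\mathcal B_i)_{i\ge-1},\mathcal A]_{\mathcal P_{\mathcal M}}$ of the hyperdoctrine of mass problems has as objects the finite powers of $\omega$ and of the sets $\{1,\dots,m\}$, and as morphisms $\alpha:Y\to Z$ the computable functions with $(\mathcal B_{\alpha(y)})_{y\in Y}\le(\mathcal B_y)_{y\in Y}$. It sends $Y$ to the Brouwer algebra $\mathcal P(Y)$ of all (degrees of) families $\mathcal F$ over $Y$ with $0_Y:=(\mathcal B_y)_{y\in Y}\le\mathcal F\le(\mathcal A)_{y\in Y}=:1_Y$, and it sends $\alpha:Y\to Z$ to $\alpha^*:\mathcal P(Z)\to\mathcal P(Y)$, $(\alpha^*\mathcal F)_y=\mathcal F_{\alpha(y)}\oplus\mathcal B_y$. **Structures.** A structure $\mathfrak M$ in the interval consists of an object $M$ (the universe), a morphism $M^n\to M$ for each $n$-ary function symbol, and an element of $\mathcal P(M^n)$ for each $n$-ary relation symbol. A formula $\varphi$ in a context of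 $n$ variables has a value $[\![\varphi]\!]\in\mathcal P(M^n)$: an atomic formula $R(t_1,\dots,t_m)$ has the value $([\![t_1]\!],\dots,[\![t_m]\!])^*[\![R]\!]$; $\top$, $\bot$, $\wedge$, $\vee$ are interpreted by $0$, $1$, $\oplus$, $\otimes$; $[\![\psi\to\theta]\!]$ is the Brouwer implication, i.e. $[\![\psi]\!]\oplus y\ge[\![\theta]\!]$ iff $y\ge[\![\psi\to\theta]\!]$ for all $y\in\mathcal P(M^n)$; and $\forall$, $\exists$ are interpreted by the left, respectively right, adjoint of $\pi^*$ for the projection $\pi:M^n\times M\to M^n$. Equality $t_1=t_2$ is interpreted by $([\![t_1]\!],[\![t_2]\!])^*({=_M})$, where $=_M\in\mathcal P(M\times M)$ is the right adjoint at $0$ of the pullback along the diagonal. Negation is $\neg\varphi:=\varphi\to\bot$. The structure $\mathfrak M$ refutes a sentence $\varphi$ if $[\![\varphi]\!]\ne 0$ in $\mathcal P(M^0)$. **Proposition.** Let $\Sigma$ be the language containing one unary relation $R$ (and no other non-logical symbols). There is an interval $[(\mathcal B_i)_{i\ge-1},\mathcal A]_{\mathcal P_{\mathcal M}}$ and a structure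 $\mathfrak M$ for $\Sigma$ in it such that $\mathfrak M$ refutes $$\forall x\,\neg\neg R(x)\ \to\ \neg\neg\,\forall x\,R(x).$$ -/

import Mathlib

universe u v

namespace MassProblems

/-! ### Turing functionals and mass problems -/

/-- The initial segment `(f 0, …, f (s - 1))` of a point `f` of Baire space. -/
def initSeg (f : ℕ → ℕ) (s : ℕ) : List ℕ := (List.range s).map f

/-- A partial Turing functional on Baire space, given by its action on finite oracle strings:
`approx σ x = some y` says that, with the finite part `σ` of the oracle, the value at the
argument `x` has already been computed to be `y`. -/
structure TuringFunctional where
  approx : List ℕ → ℕ → Option ℕ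
  computable : Computable₂ approx
  mono : ∀ (σ τ : List ℕ) (x y : ℕ), σ <+: τ → approx σ x = some y → approx τ x = some y

/-- `Φ.Maps f g` says that `Φ(f)` is total and equal to `g`. -/
def TuringFunctional.Maps (Φ : TuringFunctional) (f g : ℕ → ℕ) : Prop :=
  ∀ x, ∃ s, Φ.approx (initSeg f s) x = some (g x)

/-- The concatenation `l ⌢ f` of a finite string and a point of Baire space. -/
def prepend (l : List ℕ) (f : ℕ → ℕ) : ℕ → ℕ :=
  fun i => if i < l.length then l.getD i 0 else f (i - l.length)

/-- A mass problem is a set of points of Baire space. -/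
abbrev MassProblem := Set (ℕ → ℕ)

/-- The join `P ⊕ Q = {f ⊕ g | f ∈ P, g ∈ Q}`, where `(f ⊕ g)(2n) = f(n)` and
`(f ⊕ g)(2n+1) = g(n)`. -/
def MassProblem.join (P Q : MassProblem) : MassProblem :=
  {h | (fun n => h (2 * n)) ∈ P ∧ (fun n => h (2 * n + 1)) ∈ Q}

/-- The meet `P ⊗ Q = 0 ⌢ P ∪ 1 ⌢ Q`. -/
def MassProblem.meet (P Q : MassProblem) : MassProblem :=
  {h | (∃ f ∈ P, h = prepend [0] f) ∨ (∃ g ∈ Q, h = prepend [1] g)}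

/-- `F ≤ G` uniformly: one Turing functional `Φ` satisfies `Φ(code i ⌢ G i) ⊆ F i` for all `i`. -/
def UniformLE {ι : Type} (code : ι → List ℕ) (F G : ι → MassProblem) : Prop :=
  ∃ Φ : TuringFunctional, ∀ i, ∀ g ∈ G i, ∃ f ∈ F i, Φ.Maps (prepend (code i) g) f

/-- Medvedev reducibility `P ≤ Q`. -/
def MedvedevLE (P Q : MassProblem) : Prop :=
  UniformLE (fun _ : Unit => []) (fun _ => P) (fun _ => Q)

/-- Reducibility of `ω`-mass problems. -/
def OmegaLE (F G : ℕ → MassProblem) : Prop :=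
  UniformLE (fun n => [n]) F G

/-! ### General intervals of the hyperdoctrine of mass problems -/

/-- The data `((B_i)_{i ≥ -1}, A)` of a general interval; `Bneg` is `B_{-1}`. -/
structure Interval where
  A : MassProblem
  Bneg : MassProblem
  B : ℕ → MassProblem
  B_le_A : OmegaLE B (fun _ => A)
  Bneg_le_B : OmegaLE (fun _ => Bneg) B
  not_A_le_Bneg : ¬ MedvedevLE A Bneg
  not_A_le_B : ∀ i, ¬ MedvedevLE A (B i)

/-- The sets whose powers are the objects of the base category:
`fin m` is `{1, …, m}` and `nat` is `ω`. -/
inductive Base where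
  | fin (m : ℕ)
  | nat

def Base.toSet : Base → Set ℕ
  | .fin m => Set.Icc 1 m
  | .nat => Set.univ

/-- An object of the base category: the power `base ^ exp`. -/
structure Obj where
  base : Base
  exp : ℕ

namespace Obj

/-- The underlying set of an object: tuples `(y_1, …, y_exp)` from the base set. -/
abbrev Carrier (X : Obj) : Type := {y : Fin X.exp → ℕ // ∀ i, y i ∈ X.base.toSet}

/-- The `n`-fold product of an object with itself; a tuple of `n` tuples is written
as one tuple consisting of `n` blocks. -/
def pow (X : Obj) (n : ℕ) : Obj := ⟨X.base, n * X.exp⟩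

/-- The `i`-th product projection `X ^ n → X`. -/
def proj {X : Obj} {n : ℕ} (i : Fin n) (y : (X.pow n).Carrier) : X.Carrier :=
  ⟨fun j => y.1 (finProdFinEquiv (i, j)), fun j => y.2 (finProdFinEquiv (i, j))⟩

/-- The point of `X ^ n` with given components. -/
def tuple {X : Obj} {n : ℕ} (t : Fin n → X.Carrier) : (X.pow n).Carrier :=
  ⟨fun p => (t (finProdFinEquiv.symm p).1).1 (finProdFinEquiv.symm p).2,
    fun p => (t (finProdFinEquiv.symm p).1).2 (finProdFinEquiv.symm p).2⟩

/-- The product projection `X ^ n × X → X ^ n`. -/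
def projInit {X : Obj} {n : ℕ} (y : (X.pow (n + 1)).Carrier) : (X.pow n).Carrier :=
  tuple fun i => proj i.castSucc y

/-- The diagonal `X → X × X`. -/
def diag {X : Obj} (y : X.Carrier) : (X.pow 2).Carrier := tuple fun _ => y

/-- Families of mass problems indexed by an object. -/
abbrev Family (X : Obj) : Type := X.Carrier → MassProblem

/-- Reducibility of families, uniformly in the index. For a finite index set this is the same as
Medvedev reducibility in each component. -/
def LE (X : Obj) (F G : X.Family) : Prop :=
  UniformLE (fun y : X.Carrier => List.ofFn y.1) F G

/-- Equivalence of families: `F` and `G` have the same degree. -/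
def Equiv (X : Obj) (F G : X.Family) : Prop := X.LE F G ∧ X.LE G F

/-- Computability of a map between objects. -/
def IsComputable {X Y : Obj} (α : X.Carrier → Y.Carrier) : Prop :=
  ∃ g : (Fin X.exp → ℕ) → (Fin Y.exp → ℕ), Computable g ∧ ∀ y, (α y).1 = g y.1

end Obj

namespace Interval

variable (I : Interval)

/-- `B_{(y_1, …, y_k)} = B_{y_1} ⊕ ⋯ ⊕ B_{y_k}`, which for the empty tuple is `B_{-1}`. -/
def joinB : (k : ℕ) → (Fin k → ℕ) → MassProblem
  | 0, _ => I.Bneg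
  | 1, y => I.B (y 0)
  | k + 2, y => (I.B (y 0)).join (joinB (k + 1) fun i => y i.succ)

/-- The smallest element `0_X` over the object `X`. -/
def bot (X : Obj) : X.Family := fun y => I.joinB X.exp y.1

/-- The largest element `1_X` over the object `X`. -/
def top (X : Obj) : X.Family := fun _ => I.A

/-- Membership of (the degree of) a family in the Brouwer algebra of the interval over `X`. -/
def Mem (X : Obj) (F : X.Family) : Prop := X.LE (I.bot X) F ∧ X.LE F (I.top X)

/-- The morphisms of the base category: computable maps `α` with `B_{α(y)} ≤ B_y` uniformly. -/
def IsMorphism {X Y : Obj} (α : X.Carrier → Y.Carrier) : Prop :=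
  Obj.IsComputable α ∧ X.LE (fun y => I.bot Y (α y)) (I.bot X)

/-- The action `α^*` of the interval on a morphism `α`. -/
def pullback {X Y : Obj} (α : X.Carrier → Y.Carrier) (F : Y.Family) : X.Family :=
  fun y => (F (α y)).join (I.bot X y)

/-- `W` is the implication `U → V` of the Brouwer algebra over `X`:
`U ⊕ Y ≥ V` if and only if `Y ≥ W`. -/
def IsImp (X : Obj) (U V W : X.Family) : Prop :=
  I.Mem X W ∧ ∀ Y : X.Family, I.Mem X Y → (X.LE V (fun y => (U y).join (Y y)) ↔ X.LE W Y)

/-- `W` is the value at `U` of the left adjoint of `α^*`. -/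
def IsForall {X Y : Obj} (α : X.Carrier → Y.Carrier) (U : X.Family) (W : Y.Family) : Prop :=
  I.Mem Y W ∧ ∀ D : Y.Family, I.Mem Y D → (X.LE U (I.pullback α D) ↔ Y.LE W D)

/-- `W` is the value at `U` of the right adjoint of `α^*`. -/
def IsExists {X Y : Obj} (α : X.Carrier → Y.Carrier) (U : X.Family) (W : Y.Family) : Prop :=
  I.Mem Y W ∧ ∀ D : Y.Family, I.Mem Y D → (X.LE (I.pullback α D) U ↔ Y.LE D W)

end Interval

/-! ### First-order formulas and their interpretation -/

/-- First-order formulas in the context `x_0, …, x_{n-1}`; a quantifier binds the last variable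
of the enlarged context. -/
inductive Formula (L : FirstOrder.Language.{u, v}) : ℕ → Type (max u v)
  | top {n : ℕ} : Formula L n
  | bot {n : ℕ} : Formula L n
  | rel {n k : ℕ} (R : L.Relations k) (t : Fin k → L.Term (Fin n)) : Formula L n
  | eq {n : ℕ} (s t : L.Term (Fin n)) : Formula L n
  | and {n : ℕ} (φ ψ : Formula L n) : Formula L n
  | or {n : ℕ} (φ ψ : Formula L n) : Formula L n
  | imp {n : ℕ} (φ ψ : Formula L n) : Formula L n
  | all {n : ℕ} (φ : Formula L (n + 1)) : Formula L n
  | ex {n : ℕ} (φ : Formula L (n + 1)) : Formula L n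

/-- Intuitionistic negation `φ → ⊥`. -/
def Formula.neg {L : FirstOrder.Language.{u, v}} {n : ℕ} (φ : Formula L n) : Formula L n :=
  φ.imp .bot

/-- A structure for the language `L` in the interval `I`. -/
structure Structure (I : Interval) (L : FirstOrder.Language.{u, v}) where
  univ : Obj
  func : {n : ℕ} → L.Functions n → (univ.pow n).Carrier → univ.Carrier
  func_morphism : ∀ {n : ℕ} (f : L.Functions n), I.IsMorphism (func f)
  rel : {n : ℕ} → L.Relations n → (univ.pow n).Family
  rel_mem : ∀ {n : ℕ} (R : L.Relations n), I.Mem (univ.pow n) (rel R)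

namespace Structure

variable {I : Interval} {L : FirstOrder.Language.{u, v}} (M : Structure I L)

/-- The interpretation of a term in context as a map `M ^ n → M`. -/
def term {n : ℕ} : L.Term (Fin n) → (M.univ.pow n).Carrier → M.univ.Carrier
  | .var i => Obj.proj i
  | .func f t => fun y => M.func f (Obj.tuple fun i => term (t i) y)

/-- `M.Interp φ F` says that the family `F` represents the degree `⟦φ⟧` over `M ^ n`. The operations
are the ones of the Brouwer algebra over `M ^ n` and the adjoints of the product projections, so
that `F` is unique up to equivalence. -/
def Interp : {n : ℕ} → Formula L n → (M.univ.pow n).Family → Prop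
  | n, .top, F => (M.univ.pow n).Equiv F (I.bot _)
  | n, .bot, F => (M.univ.pow n).Equiv F (I.top _)
  | n, .rel R t, F =>
      (M.univ.pow n).Equiv F (I.pullback (fun y => Obj.tuple fun i => M.term (t i) y) (M.rel R))
  | n, .eq s t, F => ∃ E : (M.univ.pow 2).Family,
      I.IsExists Obj.diag (I.bot M.univ) E ∧
      (M.univ.pow n).Equiv F (I.pullback (fun y => Obj.tuple ![M.term s y, M.term t y]) E)
  | n, .and φ ψ, F => ∃ U V, Interp φ U ∧ Interp ψ V ∧
      (M.univ.pow n).Equiv F (fun y => (U y).join (V y))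
  | n, .or φ ψ, F => ∃ U V, Interp φ U ∧ Interp ψ V ∧
      (M.univ.pow n).Equiv F (fun y => (U y).meet (V y))
  | _, .imp φ ψ, F => ∃ U V, Interp φ U ∧ Interp ψ V ∧ I.IsImp _ U V F
  | _, .all φ, F => ∃ U, Interp φ U ∧ I.IsForall Obj.projInit U F
  | _, .ex φ, F => ∃ U, Interp φ U ∧ I.IsExists Obj.projInit U F

/-- `M` refutes the sentence `φ`: its value `⟦φ⟧` over the empty context is not the smallest
element. -/
def Refutes (φ : Formula L 0) : Prop :=
  ∃ F, M.Interp φ F ∧ ¬ (M.univ.pow 0).Equiv F (I.bot _)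

end Structure

/-- The language with one unary relation symbol and nothing else. -/
def unaryLanguage : FirstOrder.Language.{0, 0} where
  Functions := fun _ => Empty
  Relations := fun n => {_u : Unit // n = 1}

/-- The unary relation symbol `R`. -/
def symbR : unaryLanguage.Relations 1 := ⟨(), rfl⟩

/-- The atomic formula `R(x)` in the context `x`. -/
def atomR : Formula unaryLanguage 1 := .rel symbR fun _ => .var 0

/-- The sentence `∀ x ¬¬R(x) → ¬¬∀ x R(x)`. -/
def dnsR : Formula unaryLanguage 0 :=
  .imp (.all atomR.neg.neg) (Formula.all atomR).neg.neg

end MassProblems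

namespace MassProblems

/-! ### Turing functionals preserve computability -/

/-! In the interval from Baire space (truth) to the noncomputable functions (falsity), a problem
lies at the top exactly when it has no computable member. For a noncomputable `g`, let R(i) ask for
a noncomputable function or one starting with `g i`. Each R(i) has a computable solution, so ¬R is
false and ¬¬R true at every point (`isImp_top`, `isImp_top_top`), whence ∀x ¬¬R(x) is true. A
computable solution of ∀x R(x) would have to work uniformly in i, and reading off first values would
compute `g`; so ∀x R(x) is false (`isForall_valueAtom`), and so is its double negation. The sentence
thus has value 0 → 1 = 1 ≠ 0. The tool is that Turing functionals preserve computability, also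
uniformly in a parameter (`computable₂_of_maps`). -/

theorem computable_initSeg {α : Type} [Primcodable α] {k : α → ℕ → ℕ} (hk : Computable₂ k) :
    Computable₂ fun a s => initSeg (k a) s := by
  have h : Computable₂ fun (p : α × ℕ) (q : ℕ × List ℕ) => q.2 ++ [k p.1 q.1] :=
    Computable.list_concat.comp (Computable.snd.comp Computable.snd)
      (hk.comp (Computable.fst.comp Computable.fst) (Computable.fst.comp Computable.snd))
  refine (Computable.nat_rec Computable.snd (Computable.const []) h).of_eq ?_
  rintro ⟨a, s⟩
  induction s with
  | zero => rfl
  | succ s ih =>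
    simp only [initSeg, List.range_succ, List.map_append, List.map_cons, List.map_nil] at ih ⊢
    rw [← ih]

theorem TuringFunctional.initSeg_prefix (f : ℕ → ℕ) {s t : ℕ} (h : s ≤ t) :
    initSeg f s <+: initSeg f t := by
  obtain ⟨r, rfl⟩ := Nat.exists_eq_add_of_le h
  exact ⟨(List.range r).map fun i => f (s + i), by
    simp [initSeg, List.range_add, Function.comp_def]⟩

theorem TuringFunctional.approx_unique (Φ : TuringFunctional) {f : ℕ → ℕ} {s t x y z : ℕ}
    (hs : Φ.approx (initSeg f s) x = some y) (ht : Φ.approx (initSeg f t) x = some z) : y = z := by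
  rcases le_total s t with h | h
  · exact Option.some_injective _ ((Φ.mono _ _ _ _ (initSeg_prefix f h) hs).symm.trans ht)
  · exact Option.some_injective _ (hs.symm.trans (Φ.mono _ _ _ _ (initSeg_prefix f h) ht))

/-- A Turing functional maps uniformly computable oracles to uniformly computable functions. -/
theorem TuringFunctional.computable₂_of_maps (Φ : TuringFunctional) {α : Type} [Primcodable α]
    {k F : α → ℕ → ℕ} (hk : Computable₂ k) (h : ∀ a, Φ.Maps (k a) (F a)) : Computable₂ F := by
  have hc : Computable₂ fun (p : α × ℕ) (s : ℕ) => Φ.approx (initSeg (k p.1) s) p.2 :=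
    Φ.computable.comp
      ((computable_initSeg hk).comp (Computable.fst.comp Computable.fst) Computable.snd)
      (Computable.snd.comp Computable.fst)
  -- Search for any stage giving a value; by `approx_unique` whichever is found first is correct.
  refine (Partrec.rfindOpt hc).of_eq_tot ?_
  rintro ⟨a, x⟩
  have hd : (Nat.rfindOpt fun s => Φ.approx (initSeg (k a) s) x).Dom :=
    Nat.rfindOpt_dom.2 ((h a x).imp fun s hs => ⟨F a x, hs⟩)
  obtain ⟨s, hs⟩ := Nat.rfindOpt_spec (Part.get_mem hd)
  obtain ⟨t, ht⟩ := h a x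
  have e := Φ.approx_unique hs ht
  exact e ▸ Part.get_mem hd

theorem TuringFunctional.computable_of_maps (Φ : TuringFunctional) {f g : ℕ → ℕ}
    (hf : Computable f) (h : Φ.Maps f g) : Computable g :=
  (Φ.computable₂_of_maps (α := Unit) (k := fun _ => f) (F := fun _ => g)
    (hf.comp Computable.snd) fun _ => h).comp (Computable.const ()) Computable.id

theorem computable_prepend (l : List ℕ) {f : ℕ → ℕ} (hf : Computable f) :
    Computable (prepend l f) := by
  have hlt : PrimrecPred fun i => i < l.length := Primrec.nat_lt.comp .id (.const _)
  have hget : Primrec fun i => l.getD i 0 := (Primrec.list_getD 0).comp (.const l) .id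
  have hsub : Primrec fun i => i - l.length := Primrec.nat_sub.comp .id (.const _)
  exact (Computable.cond hlt.decide.to_comp hget.to_comp (hf.comp hsub.to_comp)).of_eq
    fun i => by by_cases h : i < l.length <;> simp [prepend, h]

/-- Here the index is an input, as the diagonal argument against uniform solutions requires. -/
theorem computable₂_prepend_singleton {f : ℕ → ℕ} (hf : Computable f) :
    Computable₂ fun a => prepend [a] f := by
  refine (Computable.nat_casesOn (f := fun p : ℕ × ℕ => p.2) (g := fun p => p.1)
    (h := fun _ i => f i) Computable.snd Computable.fst (hf.comp Computable.snd)).of_eq ?_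
  rintro ⟨a, _ | i⟩ <;> simp [prepend]

/-- The join `f ⊕ g` of two points of Baire space. -/
def interleave (f g : ℕ → ℕ) (n : ℕ) : ℕ := if n % 2 = 0 then f (n / 2) else g (n / 2)

theorem interleave_even (f g : ℕ → ℕ) : (fun n => interleave f g (2 * n)) = f := by
  funext n; simp [interleave]

theorem interleave_odd (f g : ℕ → ℕ) : (fun n => interleave f g (2 * n + 1)) = g := by
  funext n
  have h : (2 * n + 1) / 2 = n := by omega
  simp [interleave, Nat.add_mod, h]

theorem computable_interleave {f g : ℕ → ℕ} (hf : Computable f) (hg : Computable g) :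
    Computable (interleave f g) := by
  have hdiv : Primrec fun n : ℕ => n / 2 := Primrec.nat_div.comp .id (.const 2)
  have heq : PrimrecPred fun n : ℕ => n % 2 = 0 :=
    Primrec.eq.comp (Primrec.nat_mod.comp .id (.const 2)) (.const 0)
  exact (Computable.cond heq.decide.to_comp (hf.comp hdiv.to_comp)
    (hg.comp hdiv.to_comp)).of_eq fun n => by by_cases h : n % 2 = 0 <;> simp [interleave, h]

theorem interleave_mem_join {P Q : MassProblem} {f g : ℕ → ℕ} (hf : f ∈ P) (hg : g ∈ Q) :
    interleave f g ∈ P.join Q :=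
  ⟨by rwa [interleave_even], by rwa [interleave_odd]⟩

theorem computable_evenPart {h : ℕ → ℕ} (hh : Computable h) : Computable fun n => h (2 * n) :=
  hh.comp (Primrec.nat_mul.comp (.const 2) .id).to_comp

theorem computable_oddPart {h : ℕ → ℕ} (hh : Computable h) : Computable fun n => h (2 * n + 1) :=
  hh.comp (Primrec.succ.comp (Primrec.nat_mul.comp (.const 2) .id)).to_comp

/-! ### Deleting a prefix -/

/-- The functional which deletes the first `k` values of the oracle. -/
def TuringFunctional.shift (k : ℕ) : TuringFunctional where
  approx σ x := σ[x + k]?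
  computable := (Primrec.list_getElem?.comp Primrec.fst
    (Primrec.nat_add.comp Primrec.snd (.const k))).to_comp
  mono := by
    rintro σ _ x y ⟨ρ, rfl⟩ h
    exact List.getElem?_append_left (List.getElem?_eq_some_iff.1 h).1 ▸ h

theorem TuringFunctional.shift_maps (l : List ℕ) (f : ℕ → ℕ) :
    (shift l.length).Maps (prepend l f) f := fun x =>
  ⟨x + l.length + 1, by simp [shift, initSeg, prepend]⟩

/-- Since all index codes have the same length, one shift removes them and returns the given
solution. -/
theorem UniformLE.of_subset {ι : Type} {code : ι → List ℕ} (k : ℕ)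
    (hk : ∀ i, (code i).length = k) {F G : ι → MassProblem} (h : ∀ i, G i ⊆ F i) :
    UniformLE code F G :=
  ⟨.shift k, fun i g hg => ⟨g, h i hg, hk i ▸ TuringFunctional.shift_maps (code i) g⟩⟩

theorem Obj.LE.of_subset {X : Obj} {F G : X.Family} (h : ∀ y, G y ⊆ F y) : X.LE F G :=
  UniformLE.of_subset X.exp (fun _ => List.length_ofFn) h

/-! ### The interval between the whole space and the noncomputable functions -/

/-- The noncomputable points of Baire space. -/
def noncomp : MassProblem := {f | ¬ Computable f}

/-- For a fixed index the code is finite information, so a computable solution of `G i` would yield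
one of `F i`. -/
theorem UniformLE.subset_noncomp {ι : Type} {code : ι → List ℕ} {F G : ι → MassProblem}
    (h : UniformLE code F G) {i : ι} (hi : F i ⊆ noncomp) : G i ⊆ noncomp := by
  obtain ⟨Φ, hΦ⟩ := h
  intro g hg hc
  obtain ⟨f, hf, hm⟩ := hΦ i g hg
  exact hi hf (Φ.computable_of_maps (computable_prepend _ hc) hm)

theorem not_univ_subset_noncomp : ¬ (Set.univ : MassProblem) ⊆ noncomp := fun h =>
  h (Set.mem_univ fun _ => 0) (Computable.const 0)

/-- The interval with least element `ω^ω` over every object and greatest element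
`noncomp`. -/
def noncompInterval : Interval where
  A := noncomp
  Bneg := Set.univ
  B _ := Set.univ
  B_le_A := .of_subset 1 (fun _ => rfl) fun _ => Set.subset_univ _
  Bneg_le_B := .of_subset 1 (fun _ => rfl) fun _ => Set.subset_univ _
  not_A_le_Bneg h := not_univ_subset_noncomp (h.subset_noncomp (i := ()) le_rfl)
  not_A_le_B _ h := not_univ_subset_noncomp (h.subset_noncomp (i := ()) le_rfl)

namespace noncompInterval

theorem bot_eq (X : Obj) (y : X.Carrier) : noncompInterval.bot X y = Set.univ := by
  have h : ∀ k y, noncompInterval.joinB k y = Set.univ := by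
    intro k
    induction k using Nat.twoStepInduction with
    | zero => exact fun _ => rfl
    | one => exact fun _ => rfl
    | more k _ ih =>
      exact fun y => Set.eq_univ_of_forall fun h => ⟨trivial, ih _ ▸ Set.mem_univ _⟩
  exact h _ _

theorem bot_le {X : Obj} (F : X.Family) : X.LE (noncompInterval.bot X) F :=
  .of_subset fun y => bot_eq X y ▸ Set.subset_univ _

theorem top_le_iff {X : Obj} {F : X.Family} :
    X.LE (noncompInterval.top X) F ↔ ∀ y, F y ⊆ noncomp :=
  ⟨fun h _ => UniformLE.subset_noncomp h le_rfl, .of_subset⟩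

theorem mem_of_subset {X : Obj} {F : X.Family} (h : ∀ y, noncomp ⊆ F y) :
    noncompInterval.Mem X F :=
  ⟨bot_le F, .of_subset h⟩

theorem mem_bot (X : Obj) : noncompInterval.Mem X (noncompInterval.bot X) :=
  mem_of_subset fun y => bot_eq X y ▸ Set.subset_univ _

theorem mem_top (X : Obj) : noncompInterval.Mem X (noncompInterval.top X) :=
  mem_of_subset fun _ => le_rfl

theorem join_subset_left {P : MassProblem} (Q : MassProblem) (h : P ⊆ noncomp) :
    P.join Q ⊆ noncomp := fun _ hf hc => h hf.1 (computable_evenPart hc)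

theorem join_subset_right (P : MassProblem) {Q : MassProblem} (h : Q ⊆ noncomp) :
    P.join Q ⊆ noncomp := fun _ hf hc => h hf.2 (computable_oddPart hc)

/-- A computable member of `U y`, chosen nonuniformly in `y`, adds no power: joined with a
computable member of `Y y` it would be a computable member of the join. -/
theorem isImp_top {X : Obj} {U : X.Family} (h : ∀ y, ∃ u ∈ U y, Computable u) :
    noncompInterval.IsImp X U (noncompInterval.top X) (noncompInterval.top X) := by
  refine ⟨mem_top X, fun Y _ => ?_⟩
  rw [top_le_iff, top_le_iff]
  refine ⟨fun hY y g hg hc => ?_, fun hY y => join_subset_right _ (hY y)⟩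
  obtain ⟨u, hu, huc⟩ := h y
  exact hY y (interleave_mem_join hu hg) (computable_interleave huc hc)

theorem isImp_top_top (X : Obj) : noncompInterval.IsImp X (noncompInterval.top X)
    (noncompInterval.top X) (noncompInterval.bot X) :=
  ⟨mem_bot X, fun Y _ => ⟨fun _ => bot_le Y, fun _ =>
    top_le_iff.2 fun _ => join_subset_left _ le_rfl⟩⟩

theorem isImp_bot_top (X : Obj) : noncompInterval.IsImp X (noncompInterval.bot X)
    (noncompInterval.top X) (noncompInterval.top X) :=
  isImp_top fun y => ⟨fun _ => 0, bot_eq X y ▸ Set.mem_univ _, Computable.const 0⟩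

theorem isForall_bot {X Y : Obj} (α : X.Carrier → Y.Carrier) :
    noncompInterval.IsForall α (noncompInterval.bot X) (noncompInterval.bot Y) :=
  ⟨mem_bot Y, fun _ _ => ⟨fun _ => bot_le _, fun _ => bot_le _⟩⟩

end noncompInterval

theorem exists_noncomputable : ∃ g : ℕ → ℕ, ¬ Computable g := by
  classical
  let p : Nat.Partrec.Code → Prop := fun c => (c.eval 0).Dom
  refine ⟨fun n => if p (Denumerable.ofNat Nat.Partrec.Code n) then 1 else 0, fun hg => ?_⟩
  -- The witness is the characteristic function of the halting problem on input 0.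
  refine ComputablePred.halting_problem 0 ⟨inferInstance, ?_⟩
  have hd : Computable fun n : ℕ => decide (n = 1) :=
    (PrimrecPred.decide (Primrec.eq.comp .id (.const 1))).to_comp
  refine (hd.comp (hg.comp Computable.encode)).of_eq fun c => ?_
  by_cases h : (c.eval 0).Dom <;> simp [p, h]

/-! ### The structure -/

/-- The problem of finding a noncomputable function or, as first value, the number `n`. -/
def noncompOrValue (n : ℕ) : MassProblem := {w | Computable w → w 0 = n}

/-- The structure with universe `ω` in which `R(i)` is the problem `noncompOrValue (g i)`. -/
def valueStructure (g : ℕ → ℕ) : Structure noncompInterval unaryLanguage where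
  univ := ⟨.nat, 1⟩
  func f := f.elim
  func_morphism f := f.elim
  -- The only symbol is unary, so the sum has a single term and just reads off the argument.
  rel _ y := noncompOrValue (g (∑ i, y.1 i))
  rel_mem _ := noncompInterval.mem_of_subset fun _ _ hw hc => absurd hc hw

/-- The value of the formula `R(x)`. -/
def valueAtom (g : ℕ → ℕ) : ((valueStructure g).univ.pow 1).Family :=
  noncompInterval.pullback (fun y => Obj.tuple fun _ => (valueStructure g).term (.var 0) y)
    ((valueStructure g).rel symbR)

theorem valueAtom_eq (g : ℕ → ℕ) (y : ((valueStructure g).univ.pow 1).Carrier) :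
    valueAtom g y = (noncompOrValue (g (∑ i, y.1 i))).join Set.univ := by
  unfold valueAtom Interval.pullback
  rw [noncompInterval.bot_eq]
  have e : Obj.tuple (fun _ => (valueStructure g).term (.var 0) y) = y :=
    Subtype.ext (funext fun _ => congrArg y.1 (Subsingleton.elim (α := Fin 1) _ _))
  exact congrArg (fun z => ((valueStructure g).rel symbR z).join Set.univ) e

/-- Uniformity is decisive: one functional solving every R(i) from the same computable oracle would
compute `g`. -/
theorem isForall_valueAtom {g : ℕ → ℕ} (hg : ¬ Computable g) :
    noncompInterval.IsForall Obj.projInit (valueAtom g)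
      (noncompInterval.top ((valueStructure g).univ.pow 0)) := by
  refine ⟨noncompInterval.mem_top _, fun D _ => ?_⟩
  rw [noncompInterval.top_le_iff]
  constructor
  · rintro ⟨Φ, hΦ⟩ z d hd hc
    let y (i : ℕ) : ((valueStructure g).univ.pow 1).Carrier := ⟨fun _ => i, fun _ => trivial⟩
    -- The zero function fills the component in 0_X, which is all of Baire space.
    let h := interleave d fun _ => 0
    have hh : Computable h := computable_interleave hc (Computable.const 0)
    have key (i : ℕ) : ∃ f ∈ valueAtom g (y i), Φ.Maps (prepend [i] h) f := by
      refine hΦ (y i) h (interleave_mem_join ?_ ?_)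
      · have e : Obj.projInit (y i) = z := Subtype.ext (funext fun j =>
          (j.cast (Nat.zero_mul _)).elim0)
        exact e ▸ hd
      · exact noncompInterval.bot_eq _ _ ▸ Set.mem_univ _
    choose F hF hm using key
    have hFc : Computable₂ F := Φ.computable₂_of_maps (computable₂_prepend_singleton hh) hm
    -- The value of `F i` at 0 is also the first value of its even part, a computable solution of
    -- R(i), hence equals `g i`.
    refine hg ((hFc.comp Computable.id (Computable.const 0)).of_eq fun i => ?_)
    have hi := hF i
    rw [valueAtom_eq] at hi
    have e : ∑ j, (y i).1 j = i := Fin.sum_univ_one (fun _ : Fin 1 => i)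
    rw [e] at hi
    exact hi.1 (computable_evenPart (hFc.comp (Computable.const i) Computable.id))
  · intro hD
    -- If `D` has no computable member, the even part of `f` is noncomputable and so already solves
    -- R.
    refine .of_subset fun y f hf => ?_
    rw [valueAtom_eq]
    exact ⟨fun hc => absurd hc (hD _ hf.1), trivial⟩

theorem refutes_dnsR {g : ℕ → ℕ} (hg : ¬ Computable g) : (valueStructure g).Refutes dnsR := by
  have refl {X : Obj} (F : X.Family) : X.Equiv F F :=
    ⟨.of_subset fun _ => le_rfl, .of_subset fun _ => le_rfl⟩
  have hatom : (valueStructure g).Interp atomR (valueAtom g) := refl _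
  have hneg := noncompInterval.isImp_top (U := valueAtom g) fun y => by
    refine ⟨fun _ => g (∑ i, y.1 i), ?_, Computable.const _⟩
    rw [valueAtom_eq]
    exact ⟨fun _ => rfl, trivial⟩
  refine ⟨noncompInterval.top _, ⟨noncompInterval.bot _, noncompInterval.top _, ?_, ?_,
    noncompInterval.isImp_bot_top _⟩, fun h => ?_⟩
  · exact ⟨_, ⟨_, _, ⟨_, _, hatom, refl _, hneg⟩, refl _, noncompInterval.isImp_top_top _⟩,
      noncompInterval.isForall_bot _⟩
  · exact ⟨_, _, ⟨_, _, ⟨_, hatom, isForall_valueAtom hg⟩, refl _,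
      noncompInterval.isImp_top_top _⟩, refl _, noncompInterval.isImp_bot_top _⟩
  -- Evaluated at the empty tuple, top ≤ bottom would make every function noncomputable.
  · have hsub := noncompInterval.top_le_iff.1 h.1 ⟨fun _ => 0, fun _ => trivial⟩
    rw [noncompInterval.bot_eq] at hsub
    exact not_univ_subset_noncomp hsub

end MassProblems

theorem mainTheorem9 :
    ∃ (I : MassProblems.Interval) (M : MassProblems.Structure I MassProblems.unaryLanguage),
      M.Refutes MassProblems.dnsR := by
  obtain ⟨g, hg⟩ := MassProblems.exists_noncomputable
  exact ⟨_, _, MassProblems.refutes_dnsR hg⟩
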